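/- Let $d\ge 1$, let $\Omega\subset\mathbb{R}^d$ be a bounded open set (for instance a bounded Lipschitz domain), and let $H^1_0(\Omega)$ be the closure in $H^1(\Omega)$ of the smooth functions with compact support in $\Omega$, with the standard norm $\|v\|_{H^1_0(\Omega)}=\|\nabla v\|_{L^2(\Omega)}$. Let $\alpha>0$ and let $\Psi:[0,\infty)\to\mathbb{R}$ be continuously differentiable with derivative $\psi=\Psi'$ satisfying, for constants $M_\psi\ge m_\psi>0$, $$m_\psi(t-s)\le\psi(t^2)t-\psi(s^2)s\le M_\psi(t-s)\qquad\forall\, t\ge s\ge 0.$$ Let $f,\mathfrak{F}:\Omega\times\mathbb{R}\to\mathbb{R}$ be such that for a.e. $x\in\Omega$ and all $z\in\mathbb{R}$ the derivative $\partial_z\mathfrak{F}(x,z)$ exists and equals $f(x,z)$, where $\mathfrak{F}(\cdot,z)$ is measurable for each $z\in\mathbb{R}$ and $\mathfrak{F}(\cdot,0)\in L^1(\Omega)$. Let $r>0$ be such that $H^1_0(\Omega)\hookrightarrow L^{r+1}(\Omega)$ is continuous, i.e. there is $C_r>0$ with $\|v\|_{L^{r+1}(\Omega)}\le C_r\|\nabla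 v\|_{L^2(\Omega)}$ for all $v\in H^1_0(\Omega)$, and suppose that there are constants $c_1,c_2>0$ with $$|f(x,t)|\le c_1|t|^r+c_2\qquad\text{for a.e. }x\in\Omega\text{ and all }t\in\mathbb{R}.$$ Then the energy $$E(v)=\frac{\alpha}{2}\int_\Omega\Psi(|\nabla v|^2)\,dx-\alpha\int_\Omega\mathfrak{F}(x,v(x))\,dx$$ is well defined on $H^1_0(\Omega)$ (both integrands are integrable), and at every $v\in H^1_0(\Omega)$ it has a Gâteaux derivative $E'(v)$, a bounded linear functional on $H^1_0(\Omega)$, given by $$\langle E'(v),z\rangle=\alpha\int_\Omega\psi(|\nabla v|^2)\nabla v\cdot\nabla z\,dx-\alpha\int_\Omega f(\cdot,v)z\,dx\qquad\forall z\in H^1_0(\Omega),$$ with integrable integrands. Moreover, for every norm $\|\cdot\|$ on $H^1_0(\Omega)$ equivalent to $\|\cdot\|_{H^1_0(\Omega)}$, property (B) holds: for any $w\in H^1_0(\Omega)$ and any $\varrho>0$ there exists $R\ge 0$ such that $\sup_{\|z\|=1}|\langle E'(v),z\rangle|\le R$ for all $v\in H^1_0(\Omega)$ with $\|w-v\|\le\varrho$.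 -/

import Mathlib

open MeasureTheory Set Filter Topology
open scoped ENNReal ContDiff

noncomputable section

namespace DiffusionReaction

/-- Smooth functions on `ℝ^d` with compact support contained in `Ω`. -/
def IsTestFunction {d : ℕ} (Ω : Set (EuclideanSpace ℝ (Fin d)))
    (φ : EuclideanSpace ℝ (Fin d) → ℝ) : Prop :=
  ContDiff ℝ ∞ φ ∧ HasCompactSupport φ ∧ tsupport φ ⊆ Ω

theorem IsTestFunction.differentiable {d : ℕ} {Ω : Set (EuclideanSpace ℝ (Fin d))}
    {φ : EuclideanSpace ℝ (Fin d) → ℝ} (h : IsTestFunction Ω φ) : Differentiable ℝ φ :=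
  h.1.differentiable (by simp)

theorem IsTestFunction.zero {d : ℕ} (Ω : Set (EuclideanSpace ℝ (Fin d))) :
    IsTestFunction Ω (fun _ => 0) := by
  refine ⟨contDiff_const, HasCompactSupport.zero, ?_⟩
  simp [tsupport, Function.support]

theorem IsTestFunction.add {d : ℕ} {Ω : Set (EuclideanSpace ℝ (Fin d))}
    {φ η : EuclideanSpace ℝ (Fin d) → ℝ} (hφ : IsTestFunction Ω φ) (hη : IsTestFunction Ω η) :
    IsTestFunction Ω (fun x => φ x + η x) :=
  ⟨hφ.1.add hη.1, hφ.2.1.add hη.2.1,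
    (tsupport_add φ η).trans (union_subset hφ.2.2 hη.2.2)⟩

theorem IsTestFunction.smul {d : ℕ} {Ω : Set (EuclideanSpace ℝ (Fin d))}
    {φ : EuclideanSpace ℝ (Fin d) → ℝ} (c : ℝ) (hφ : IsTestFunction Ω φ) :
    IsTestFunction Ω (fun x => c * φ x) :=
  ⟨contDiff_const.mul hφ.1, hφ.2.1.mul_left,
    (tsupport_mul_subset_right (f := fun _ => c) (g := φ)).trans hφ.2.2⟩

/-- `L²(Ω) × L²(Ω; ℝ^d)`, the space in which the pairs `(u, ∇u)` live. Its product topology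
restricted to `H¹(Ω)` is the topology of the `H¹`-norm. -/
abbrev L2Pair {d : ℕ} (Ω : Set (EuclideanSpace ℝ (Fin d))) : Type :=
  Lp ℝ 2 (volume.restrict Ω) × Lp (EuclideanSpace ℝ (Fin d)) 2 (volume.restrict Ω)

theorem integrable_smul_gradient {d : ℕ} {Ω : Set (EuclideanSpace ℝ (Fin d))}
    (u : Lp ℝ 2 (volume.restrict Ω)) {φ : EuclideanSpace ℝ (Fin d) → ℝ}
    (hφ : IsTestFunction Ω φ) :
    Integrable (fun x => u x • gradient φ x) (volume.restrict Ω) := by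
  have hc : Continuous (gradient φ) :=
    (InnerProductSpace.toDual ℝ _).symm.continuous.comp (hφ.1.continuous_fderiv (by simp))
  have hs : HasCompactSupport (gradient φ) := by
    refine (hφ.2.1.fderiv (𝕜 := ℝ)).mono ?_
    intro x hx hx'
    exact hx (by simp [gradient, hx'])
  exact memLp_one_iff_integrable.mp
    ((hc.memLp_of_hasCompactSupport (p := 2) hs).smul (Lp.memLp u))

theorem integrable_test_smul {d : ℕ} {Ω : Set (EuclideanSpace ℝ (Fin d))}
    (g : Lp (EuclideanSpace ℝ (Fin d)) 2 (volume.restrict Ω))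
    {φ : EuclideanSpace ℝ (Fin d) → ℝ} (hφ : IsTestFunction Ω φ) :
    Integrable (fun x => φ x • g x) (volume.restrict Ω) :=
  memLp_one_iff_integrable.mp
    ((Lp.memLp g).smul (hφ.1.continuous.memLp_of_hasCompactSupport (p := 2) hφ.2.1))

/-- The Sobolev space `H¹(Ω)`: pairs `(u, g)` with `u ∈ L²(Ω)` and `g ∈ L²(Ω; ℝ^d)` the weak
gradient of `u`, i.e. `∫_Ω u ∇φ = -∫_Ω φ g` (as vectors in `ℝ^d`) for all test functions `φ`. -/
def H1 {d : ℕ} (Ω : Set (EuclideanSpace ℝ (Fin d))) : Submodule ℝ (L2Pair Ω) where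
  carrier := {p | ∀ φ, IsTestFunction Ω φ →
    ∫ x in Ω, p.1 x • gradient φ x = -∫ x in Ω, φ x • p.2 x}
  zero_mem' := by
    intro φ _
    have h1 : (fun x => (0 : L2Pair Ω).1 x • gradient φ x) =ᵐ[volume.restrict Ω] 0 := by
      filter_upwards [Lp.coeFn_zero ℝ 2 (volume.restrict Ω)] with x hx
      simp only [Prod.fst_zero, hx, Pi.zero_apply, zero_smul]
    have h2 : (fun x => φ x • (0 : L2Pair Ω).2 x) =ᵐ[volume.restrict Ω] 0 := by
      filter_upwards [Lp.coeFn_zero (EuclideanSpace ℝ (Fin d)) 2 (volume.restrict Ω)] with x hx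
      simp only [Prod.snd_zero, hx, Pi.zero_apply, smul_zero]
    rw [integral_congr_ae h1, integral_congr_ae h2]
    simp
  add_mem' := by
    intro p q hp hq φ hφ
    have h1 : (fun x => (p + q).1 x • gradient φ x) =ᵐ[volume.restrict Ω]
        fun x => p.1 x • gradient φ x + q.1 x • gradient φ x := by
      filter_upwards [Lp.coeFn_add p.1 q.1] with x hx
      simp only [Prod.fst_add, hx, Pi.add_apply, add_smul]
    have h2 : (fun x => φ x • (p + q).2 x) =ᵐ[volume.restrict Ω]
        fun x => φ x • p.2 x + φ x • q.2 x := by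
      filter_upwards [Lp.coeFn_add p.2 q.2] with x hx
      simp only [Prod.snd_add, hx, Pi.add_apply, smul_add]
    rw [integral_congr_ae h1, integral_congr_ae h2,
      integral_add (integrable_smul_gradient p.1 hφ) (integrable_smul_gradient q.1 hφ),
      integral_add (integrable_test_smul p.2 hφ) (integrable_test_smul q.2 hφ),
      hp φ hφ, hq φ hφ, neg_add]
  smul_mem' := by
    intro c p hp φ hφ
    have h1 : (fun x => (c • p).1 x • gradient φ x) =ᵐ[volume.restrict Ω]
        fun x => c • (p.1 x • gradient φ x) := by
      filter_upwards [Lp.coeFn_smul c p.1] with x hx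
      simp only [Prod.smul_fst, hx, Pi.smul_apply, smul_assoc]
    have h2 : (fun x => φ x • (c • p).2 x) =ᵐ[volume.restrict Ω]
        fun x => c • (φ x • p.2 x) := by
      filter_upwards [Lp.coeFn_smul c p.2] with x hx
      simp only [Prod.smul_snd, hx, Pi.smul_apply, smul_comm c]
    rw [integral_congr_ae h1, integral_congr_ae h2, integral_smul, integral_smul,
      hp φ hφ, smul_neg]

/-- The pairs `(φ, ∇φ)` with `φ` a test function on `Ω`. -/
def testPairs {d : ℕ} (Ω : Set (EuclideanSpace ℝ (Fin d))) : Submodule ℝ (L2Pair Ω) where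
  carrier := {p | ∃ φ, IsTestFunction Ω φ ∧
    p.1 =ᵐ[volume.restrict Ω] φ ∧ p.2 =ᵐ[volume.restrict Ω] gradient φ}
  zero_mem' := by
    refine ⟨fun _ => 0, IsTestFunction.zero Ω, Lp.coeFn_zero ℝ 2 _, ?_⟩
    filter_upwards [Lp.coeFn_zero (EuclideanSpace ℝ (Fin d)) 2 (volume.restrict Ω)] with x hx
    simp only [Prod.snd_zero, hx, Pi.zero_apply, gradient]
    simp
  add_mem' := by
    rintro p q ⟨φ, hφ, hp1, hp2⟩ ⟨η, hη, hq1, hq2⟩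
    refine ⟨fun x => φ x + η x, hφ.add hη, ?_, ?_⟩
    · filter_upwards [Lp.coeFn_add p.1 q.1, hp1, hq1] with x hx h1 h2
      simp only [Prod.fst_add, hx, Pi.add_apply, h1, h2]
    · filter_upwards [Lp.coeFn_add p.2 q.2, hp2, hq2] with x hx h1 h2
      simp only [Prod.snd_add, hx, Pi.add_apply, h1, h2, gradient]
      rw [← map_add, fderiv_fun_add (hφ.differentiable x) (hη.differentiable x)]
  smul_mem' := by
    rintro c p ⟨φ, hφ, hp1, hp2⟩
    refine ⟨fun x => c * φ x, hφ.smul c, ?_, ?_⟩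
    · filter_upwards [Lp.coeFn_smul c p.1, hp1] with x hx h1
      simp only [Prod.smul_fst, hx, Pi.smul_apply, h1, smul_eq_mul]
    · filter_upwards [Lp.coeFn_smul c p.2, hp2] with x hx h1
      simp only [Prod.smul_snd, hx, Pi.smul_apply, h1, gradient]
      rw [fderiv_const_mul (hφ.differentiable x)]
      simp

/-- The Sobolev space `H¹₀(Ω)`: the closure of the test functions in `H¹(Ω)`. -/
def H10 {d : ℕ} (Ω : Set (EuclideanSpace ℝ (Fin d))) : Submodule ℝ (L2Pair Ω) :=
  H1 Ω ⊓ (testPairs Ω).topologicalClosure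

variable {d : ℕ} {Ω : Set (EuclideanSpace ℝ (Fin d))}

/-- The function underlying an element of `H¹₀(Ω)`. -/
def fn (v : H10 Ω) : Lp ℝ 2 (volume.restrict Ω) := v.1.1

/-- The weak gradient of an element of `H¹₀(Ω)`. The standard norm of `H¹₀(Ω)` is
`‖wgrad v‖ = ‖∇v‖_{L²(Ω)}`. -/
def wgrad (v : H10 Ω) : Lp (EuclideanSpace ℝ (Fin d)) 2 (volume.restrict Ω) := v.1.2

/-- `N` is equivalent to the standard norm `v ↦ ‖∇v‖_{L²(Ω)}` of `H¹₀(Ω)`. -/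
def IsEquivalentNorm (N : Seminorm ℝ (H10 Ω)) : Prop :=
  ∃ a b : ℝ, 0 < a ∧ 0 < b ∧ ∀ v : H10 Ω, a * ‖wgrad v‖ ≤ N v ∧ N v ≤ b * ‖wgrad v‖

/-- The embedding `H¹₀(Ω) ↪ L^q(Ω)` is continuous. -/
def ContinuousSobolevEmbedding (Ω : Set (EuclideanSpace ℝ (Fin d))) (q : ℝ) : Prop :=
  ∃ C : ℝ, 0 < C ∧ ∀ v : H10 Ω,
    eLpNorm (fn v) (ENNReal.ofReal q) (volume.restrict Ω) ≤ ENNReal.ofReal (C * ‖wgrad v‖)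

/-- The dual norm `sup_{N z = 1} |ℓ z|`, with values in `[0, ∞]`. -/
def dualNorm (N : Seminorm ℝ (H10 Ω)) (ℓ : H10 Ω →ₗ[ℝ] ℝ) : ℝ≥0∞ :=
  ⨆ (z : H10 Ω) (_ : N z = 1), ENNReal.ofReal |ℓ z|

/-- `ℓ` is the Gateaux derivative of `E` at `u`: a bounded linear functional with
`ℓ v = lim_{t → 0} (E (u + t v) - E u) / t` for all `v`. -/
def IsGateauxDeriv (N : Seminorm ℝ (H10 Ω)) (E : H10 Ω → ℝ) (u : H10 Ω)
    (ℓ : H10 Ω →ₗ[ℝ] ℝ) : Prop :=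
  dualNorm N ℓ < ⊤ ∧
    ∀ v : H10 Ω, Tendsto (fun t : ℝ => (E (u + t • v) - E u) / t) (𝓝[≠] 0) (𝓝 (ℓ v))

/-- Property (B), local boundedness of `E'` with respect to the norm `N`. -/
def PropertyB (N : Seminorm ℝ (H10 Ω)) (E' : H10 Ω → (H10 Ω →ₗ[ℝ] ℝ)) : Prop :=
  ∀ w : H10 Ω, ∀ ρ : ℝ, 0 < ρ → ∃ R : ℝ, 0 ≤ R ∧
    ∀ v : H10 Ω, N (w - v) ≤ ρ → dualNorm N (E' v) ≤ ENNReal.ofReal R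

/-- The energy `E(v) = α/2 ∫_Ω Ψ(|∇v|²) - α ∫_Ω F(x, v(x))`. -/
def energy (α : ℝ) (Ψ : ℝ → ℝ) (F : EuclideanSpace ℝ (Fin d) → ℝ → ℝ) (v : H10 Ω) : ℝ :=
  α / 2 * (∫ x in Ω, Ψ (‖wgrad v x‖ ^ 2)) - α * ∫ x in Ω, F x (fn v x)

end DiffusionReaction

end

open DiffusionReaction

/-! Everything is integration of pointwise bounds. Monotonicity against `s = 0` gives `0 ≤ ψ(t²)t ≤
M t`, so the flux grows at most linearly and `ψ(|∇v|²)∇v·∇z` is dominated by `M|∇v||∇z|`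
(`abs_flux_le`). The growth of `f` dominates `f(x,v)z` by a combination of `|v|^(r+1)`, `|z|^(r+1)`
and a constant (`growth_mul_le`), which is integrable because of the Sobolev embedding and because
`Ω` has finite measure. The mean value inequality turns these into integrability of the two energy
densities. Dominated differentiation along lines (`hasDerivAt_integral_density`,
`hasDerivAt_integral_potential`) gives the Gâteaux derivative. The resulting bound on `|E'(v) z|`
depends only on upper bounds for `‖∇v‖` and `‖∇z‖`. It is not homogeneous in `z`, but the dual norm
tests only `N z = 1`, so (B) follows. -/

namespace DiffusionReaction

/-! ### Superposition operators and the reaction term. -/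

section Nemytskii

variable {X : Type*} [MeasurableSpace X] {μ : Measure X}

/-- The superposition of a Caratheodory function with a measurable function is measurable. -/
theorem aestronglyMeasurable_caratheodory {F : X → ℝ → ℝ}
    (hmeas : ∀ z, AEStronglyMeasurable (fun x => F x z) μ)
    (hcont : ∀ᵐ x ∂μ, Continuous (F x)) {u : X → ℝ} (hu : AEStronglyMeasurable u μ) :
    AEStronglyMeasurable (fun x => F x (u x)) μ := by
  -- For simple `s` only finitely many slices `F(·, c)` occur; continuity in `z` then passes to
  -- pointwise limits of simple functions.
  have hsimple : ∀ s : SimpleFunc X ℝ, AEStronglyMeasurable (fun x => F x (s x)) μ := by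
    intro s
    have h : (fun x => F x (s x)) =
        fun x => ∑ c ∈ s.range, (s ⁻¹' {c}).indicator (fun x => F x c) x := by
      funext x
      rw [Finset.sum_eq_single (s x)]
      · simp
      · intro c _ hc
        exact indicator_of_notMem (fun h => hc (by simpa using h.symm)) _
      · intro h
        exact absurd (s.mem_range_self x) h
    rw [h]
    exact Finset.aestronglyMeasurable_fun_sum _
      fun c _ => (hmeas c).indicator (s.measurableSet_preimage {c})
  have hmk : AEStronglyMeasurable (fun x => F x (hu.mk u x)) μ := by
    refine aestronglyMeasurable_of_tendsto_ae (u := atTop)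
      (f := fun n x => F x (hu.stronglyMeasurable_mk.approx n x)) (fun n => hsimple _) ?_
    filter_upwards [hcont] with x hx
    exact (hx.tendsto _).comp (hu.stronglyMeasurable_mk.tendsto_approx x)
  refine hmk.congr ?_
  filter_upwards [hu.ae_eq_mk] with x hx
  rw [hx]

/-- The superposition of the derivative of a Caratheodory function with a measurable function is
measurable. -/
theorem aestronglyMeasurable_deriv_caratheodory {F f : X → ℝ → ℝ}
    (hmeas : ∀ z, AEStronglyMeasurable (fun x => F x z) μ)
    (hF : ∀ᵐ x ∂μ, ∀ z, HasDerivAt (F x) (f x z) z) {u : X → ℝ} (hu : AEStronglyMeasurable u μ) :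
    AEStronglyMeasurable (fun x => f x (u x)) μ := by
  have hcont : ∀ᵐ x ∂μ, Continuous (F x) := by
    filter_upwards [hF] with x hx
    exact continuous_iff_continuousAt.2 fun z => (hx z).continuousAt
  have hc : ∀ t : ℝ, AEStronglyMeasurable (fun x => F x (u x + t)) μ := fun t =>
    aestronglyMeasurable_caratheodory hmeas hcont (hu.add aestronglyMeasurable_const)
  -- Measurability of `f` is inherited from `F` through difference quotients.
  refine aestronglyMeasurable_of_tendsto_ae (𝓝[≠] (0 : ℝ))
    (f := fun t x => t⁻¹ • (F x (u x + t) - F x (u x))) (fun t => ?_) ?_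
  · have h0 := hc 0
    simp only [add_zero] at h0
    exact ((hc t).sub h0).const_smul t⁻¹
  · filter_upwards [hF] with x hx
    exact (hx (u x)).tendsto_slope_zero

theorem rpow_mul_le_rpow_add_one {r a b : ℝ} (hr : 0 < r) (ha : 0 ≤ a) (hb : 0 ≤ b) :
    a ^ r * b ≤ a ^ (r + 1) + b ^ (r + 1) := by
  have h : ∀ {c : ℝ}, 0 ≤ c → c ^ (r + 1) = c ^ r * c := fun hc =>
    Real.rpow_add_one' hc (by positivity)
  rcases le_total a b with hab | hab
  · have h1 : a ^ r * b ≤ b ^ r * b := by gcongr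
    have h2 := Real.rpow_nonneg ha (r + 1)
    rw [h hb]; linarith
  · have h1 : a ^ r * b ≤ a ^ r * a := by gcongr
    have h2 := Real.rpow_nonneg hb (r + 1)
    rw [h ha]; linarith

theorem le_one_add_rpow {q b : ℝ} (hq : 1 ≤ q) (hb : 0 ≤ b) : b ≤ 1 + b ^ q := by
  have h2 := Real.rpow_nonneg hb q
  rcases le_total b 1 with h | h
  · linarith
  · linarith [Real.self_le_rpow_of_one_le h hq]

variable {F f : X → ℝ → ℝ} {r c₁ c₂ : ℝ}

/-- A crude substitute for Young's inequality: the larger of `|s|`, `|b|` absorbs the product. It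
serves both as dominating function and as estimate of the derivative. -/
theorem growth_mul_le (hr : 0 < r) (hc₁ : 0 ≤ c₁) (hc₂ : 0 ≤ c₂) {y s b : ℝ}
    (h : |y| ≤ c₁ * |s| ^ r + c₂) :
    |y * b| ≤ c₁ * (|s| ^ (r + 1) + |b| ^ (r + 1)) + c₂ * (1 + |b| ^ (r + 1)) := by
  rw [abs_mul]
  calc |y| * |b| ≤ (c₁ * |s| ^ r + c₂) * |b| := by gcongr
    _ = c₁ * (|s| ^ r * |b|) + c₂ * |b| := by ring
    _ ≤ _ := by
      gcongr
      · exact rpow_mul_le_rpow_add_one hr (abs_nonneg _) (abs_nonneg _)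
      · exact le_one_add_rpow (by linarith) (abs_nonneg _)

theorem integrable_abs_rpow (hr : 0 < r) {u : X → ℝ} (hu : MemLp u (ENNReal.ofReal (r + 1)) μ) :
    Integrable (fun x => |u x| ^ (r + 1)) μ := by
  have h := hu.integrable_norm_rpow (by simp; linarith) (by simp)
  rwa [ENNReal.toReal_ofReal (by linarith)] at h

/-- The dominating function of the reaction term. -/
theorem integrable_growth_bound [IsFiniteMeasure μ] (hr : 0 < r) {u w : X → ℝ}
    (hu : MemLp u (ENNReal.ofReal (r + 1)) μ) (hw : MemLp w (ENNReal.ofReal (r + 1)) μ) :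
    Integrable (fun x => c₁ * (|u x| ^ (r + 1) + |w x| ^ (r + 1)) + c₂ * (1 + |w x| ^ (r + 1)))
      μ :=
  (((integrable_abs_rpow hr hu).add (integrable_abs_rpow hr hw)).const_mul c₁).add
    (((integrable_const 1).add (integrable_abs_rpow hr hw)).const_mul c₂)

theorem integrable_potential [IsFiniteMeasure μ]
    (hFmeas : ∀ z, AEStronglyMeasurable (fun x => F x z) μ)
    (hFint : Integrable (fun x => F x 0) μ)
    (hFf : ∀ᵐ x ∂μ, ∀ z, HasDerivAt (F x) (f x z) z)
    (hr : 0 < r) (hc₁ : 0 ≤ c₁) (hc₂ : 0 ≤ c₂)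
    (hgrowth : ∀ᵐ x ∂μ, ∀ t, |f x t| ≤ c₁ * |t| ^ r + c₂)
    {u : X → ℝ} (hu : MemLp u (ENNReal.ofReal (r + 1)) μ) :
    Integrable (fun x => F x (u x)) μ := by
  have hcont : ∀ᵐ x ∂μ, Continuous (F x) := by
    filter_upwards [hFf] with x hx
    exact continuous_iff_continuousAt.2 fun z => (hx z).continuousAt
  refine (hFint.norm.add (integrable_growth_bound (c₁ := c₁) (c₂ := c₂) hr hu hu)).mono'
    (aestronglyMeasurable_caratheodory hFmeas hcont hu.1) ?_
  filter_upwards [hFf, hgrowth] with x hx hg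
  have hd : ∀ t ∈ Icc (0 : ℝ) 1, HasDerivWithinAt (fun t => F x (t * u x))
      (f x (t * u x) * u x) (Icc 0 1) t := fun t _ => by
    have := (hx (t * u x)).comp t ((hasDerivAt_id t).mul_const (u x))
    simpa [Function.comp_def] using this.hasDerivWithinAt
  -- The mean value inequality along `t ↦ F(x, t u(x))` requires no continuity of `f` in `z`.
  have := norm_image_sub_le_of_norm_deriv_le_segment_01' hd
    (C := c₁ * (|u x| ^ (r + 1) + |u x| ^ (r + 1)) + c₂ * (1 + |u x| ^ (r + 1))) (by
      intro t ht
      refine (growth_mul_le (b := u x) hr hc₁ hc₂ (hg (t * u x))).trans ?_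
      have : |t * u x| ≤ |u x| := by
        rw [abs_mul, abs_of_nonneg ht.1]
        exact mul_le_of_le_one_left (abs_nonneg _) ht.2.le
      gcongr)
  simp only [one_mul, zero_mul] at this
  have h2 := norm_le_norm_add_norm_sub' (F x (u x)) (F x 0)
  simp only [Pi.add_apply]
  linarith

/-- Differentiation of the reaction term along a line. -/
theorem hasDerivAt_integral_potential [IsFiniteMeasure μ]
    (hFmeas : ∀ z, AEStronglyMeasurable (fun x => F x z) μ)
    (hFint : Integrable (fun x => F x 0) μ)
    (hFf : ∀ᵐ x ∂μ, ∀ z, HasDerivAt (F x) (f x z) z)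
    (hr : 0 < r) (hc₁ : 0 ≤ c₁) (hc₂ : 0 ≤ c₂)
    (hgrowth : ∀ᵐ x ∂μ, ∀ t, |f x t| ≤ c₁ * |t| ^ r + c₂)
    {u w : X → ℝ} (hu : MemLp u (ENNReal.ofReal (r + 1)) μ)
    (hw : MemLp w (ENNReal.ofReal (r + 1)) μ) :
    Integrable (fun x => f x (u x) * w x) μ ∧
      HasDerivAt (fun t : ℝ => ∫ x, F x (u x + t * w x) ∂μ) (∫ x, f x (u x) * w x ∂μ) 0 := by
  have hline : ∀ t : ℝ, MemLp (fun x => u x + t * w x) (ENNReal.ofReal (r + 1)) μ := fun t =>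
    hu.add (hw.const_mul t)
  have hint : ∀ t : ℝ, Integrable (fun x => F x (u x + t * w x)) μ := fun t =>
    integrable_potential hFmeas hFint hFf hr hc₁ hc₂ hgrowth (hline t)
  have hsum : MemLp (fun x => |u x| + |w x|) (ENNReal.ofReal (r + 1)) μ := hu.abs.add hw.abs
  -- For `|t| < 1`, `|u + t w| ≤ |u| + |w|`, so one bound serves all `t`. The outer absolute value
  -- gives it the shape required by `integrable_growth_bound`.
  have key := hasDerivAt_integral_of_dominated_loc_of_deriv_le (μ := μ)
    (F := fun t x => F x (u x + t * w x)) (F' := fun t x => f x (u x + t * w x) * w x)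
    (x₀ := (0 : ℝ)) (s := Metric.ball 0 1) (bound := fun x =>
      c₁ * (|(|u x| + |w x|)| ^ (r + 1) + |w x| ^ (r + 1)) + c₂ * (1 + |w x| ^ (r + 1)))
    (Metric.ball_mem_nhds _ one_pos) (Eventually.of_forall fun t => (hint t).1) (hint 0)
    ((aestronglyMeasurable_deriv_caratheodory hFmeas hFf (hline 0).1).mul hw.1) (by
      filter_upwards [hgrowth] with x hg t ht
      refine (growth_mul_le (b := w x) hr hc₁ hc₂ (hg (u x + t * w x))).trans ?_
      have ht1 : |t| ≤ 1 := by simpa using (mem_ball_zero_iff.1 ht).le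
      have : |u x + t * w x| ≤ |(|u x| + |w x|)| := by
        rw [abs_of_nonneg (a := |u x| + |w x|) (by positivity)]
        refine (abs_add_le _ _).trans ?_
        rw [abs_mul]
        gcongr
        exact mul_le_of_le_one_left (abs_nonneg _) ht1
      gcongr) (integrable_growth_bound hr hsum hw) (by
      filter_upwards [hFf] with x hx t _
      have := (hx (u x + t * w x)).comp t (((hasDerivAt_id t).mul_const (w x)).const_add (u x))
      simpa [Function.comp_def] using this)
  simpa using key

theorem abs_integral_reaction_le [IsFiniteMeasure μ] (hr : 0 < r) (hc₁ : 0 ≤ c₁) (hc₂ : 0 ≤ c₂)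
    (hgrowth : ∀ᵐ x ∂μ, ∀ t, |f x t| ≤ c₁ * |t| ^ r + c₂)
    {u w : X → ℝ} (hu : MemLp u (ENNReal.ofReal (r + 1)) μ)
    (hw : MemLp w (ENNReal.ofReal (r + 1)) μ) :
    |∫ x, f x (u x) * w x ∂μ| ≤
      c₁ * ((∫ x, |u x| ^ (r + 1) ∂μ) + ∫ x, |w x| ^ (r + 1) ∂μ) +
        c₂ * (μ.real univ + ∫ x, |w x| ^ (r + 1) ∂μ) := by
  have iu := integrable_abs_rpow hr hu
  have iw := integrable_abs_rpow hr hw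
  have hgb : ∀ᵐ x ∂μ, ‖f x (u x) * w x‖ ≤
      c₁ * (|u x| ^ (r + 1) + |w x| ^ (r + 1)) + c₂ * (1 + |w x| ^ (r + 1)) := by
    filter_upwards [hgrowth] with x hx
    exact growth_mul_le hr hc₁ hc₂ (hx _)
  refine (norm_integral_le_of_norm_le (integrable_growth_bound hr hu hw) hgb).trans_eq ?_
  have h1 : Integrable (fun x => c₁ * (|u x| ^ (r + 1) + |w x| ^ (r + 1))) μ :=
    (iu.add iw).const_mul c₁
  have h2 : Integrable (fun x => c₂ * (1 + |w x| ^ (r + 1))) μ :=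
    ((integrable_const 1).add iw).const_mul c₂
  rw [integral_add h1 h2, integral_const_mul, integral_const_mul, integral_add iu iw,
    integral_add (integrable_const 1) iw, integral_const, smul_eq_mul, mul_one]

end Nemytskii

/-! ### The diffusion term. -/

section Diffusion

theorem continuous_comp_norm_sq {V : Type*} [SeminormedAddCommGroup V] {g : ℝ → ℝ}
    (hg : ContinuousOn g (Ici 0)) :
    Continuous fun a : V => g (‖a‖ ^ 2) :=
  hg.comp_continuous (by fun_prop) fun a => by simp only [mem_Ici]; positivity

variable {X : Type*} [MeasurableSpace X] {μ : Measure X}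
  {V : Type*} [NormedAddCommGroup V] [InnerProductSpace ℝ V]
  {Ψ ψ : ℝ → ℝ} {M : ℝ}

/-- Cauchy–Schwarz supplies the factor `‖a‖` that pairs with `ψ`, so no division is needed at `a =
0`. -/
theorem abs_flux_le (hψ : ∀ t, 0 ≤ t → |ψ (t ^ 2) * t| ≤ M * t) (a b : V) :
    |ψ (‖a‖ ^ 2) * inner ℝ a b| ≤ M * ‖a‖ * ‖b‖ := by
  have h := hψ ‖a‖ (norm_nonneg _)
  rw [abs_mul, abs_norm] at h
  calc |ψ (‖a‖ ^ 2) * inner ℝ a b| ≤ |ψ (‖a‖ ^ 2)| * (‖a‖ * ‖b‖) := by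
        rw [abs_mul]
        gcongr
        exact abs_real_inner_le_norm a b
    _ = |ψ (‖a‖ ^ 2)| * ‖a‖ * ‖b‖ := by ring
    _ ≤ _ := by gcongr

/-- Since `‖a + t b‖²` never leaves `[0, ∞)`, the one-sided derivative of `Ψ` at `0` is enough for a
two-sided derivative in `t`. -/
theorem hasDerivAt_density (hΨ : ∀ s, 0 ≤ s → HasDerivWithinAt Ψ (ψ s) (Ici 0) s) (a b : V)
    (t : ℝ) : HasDerivAt (fun t : ℝ => Ψ (‖a + t • b‖ ^ 2))
      (2 * (ψ (‖a + t • b‖ ^ 2) * inner ℝ (a + t • b) b)) t := by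
  have h1 : HasDerivAt (fun t : ℝ => ‖a + t • b‖ ^ 2) (2 * inner ℝ (a + t • b) b) t := by
    have h0 : HasDerivAt (fun t : ℝ => a + t • b) b t := by
      simpa using ((hasDerivAt_id t).smul_const b).const_add a
    exact h0.norm_sq
  refine ((hΨ (‖a + t • b‖ ^ 2) (by positivity)).comp_hasDerivAt t h1
    (Eventually.of_forall fun t => by simp only [mem_Ici]; positivity)).congr_deriv ?_
  ring

theorem integrable_density [IsFiniteMeasure μ]
    (hΨ : ∀ s, 0 ≤ s → HasDerivWithinAt Ψ (ψ s) (Ici 0) s)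
    (hM : 0 ≤ M) (hψ : ∀ t, 0 ≤ t → |ψ (t ^ 2) * t| ≤ M * t) {g : X → V} (hg : MemLp g 2 μ) :
    Integrable (fun x => Ψ (‖g x‖ ^ 2)) μ := by
  refine ((integrable_const |Ψ 0|).add (hg.integrable_norm_pow'.const_mul (2 * M))).mono'
    ((continuous_comp_norm_sq fun s hs => (hΨ s hs).continuousWithinAt).comp_aestronglyMeasurable
      hg.1) (Eventually.of_forall fun x => ?_)
  -- Along the segment from `0` to `g(x)` this yields `|Ψ(|g|²)| ≤ |Ψ(0)| + 2M|g|²`.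
  have := norm_image_sub_le_of_norm_deriv_le_segment_01' (C := 2 * (M * ‖g x‖ * ‖g x‖))
    (fun t _ => (hasDerivAt_density hΨ 0 (g x) t).hasDerivWithinAt) (by
      intro t ht
      rw [norm_mul, Real.norm_ofNat]
      gcongr
      refine (abs_flux_le hψ _ _).trans ?_
      gcongr
      rw [zero_add, norm_smul, Real.norm_of_nonneg ht.1]
      exact mul_le_of_le_one_left (norm_nonneg _) ht.2.le)
  simp only [zero_add, one_smul, zero_smul, norm_zero] at this
  have h2 := norm_le_norm_add_norm_sub' (Ψ (‖g x‖ ^ 2)) (Ψ 0)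
  simp only [Pi.add_apply] at *
  norm_num at *
  nlinarith

/-- Differentiation of the diffusion term along a line. -/
theorem hasDerivAt_integral_density [IsFiniteMeasure μ]
    (hΨ : ∀ s, 0 ≤ s → HasDerivWithinAt Ψ (ψ s) (Ici 0) s) (hψc : ContinuousOn ψ (Ici 0))
    (hM : 0 ≤ M) (hψ : ∀ t, 0 ≤ t → |ψ (t ^ 2) * t| ≤ M * t) {g k : X → V}
    (hg : MemLp g 2 μ) (hk : MemLp k 2 μ) :
    Integrable (fun x => ψ (‖g x‖ ^ 2) * inner ℝ (g x) (k x)) μ ∧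
      HasDerivAt (fun t : ℝ => ∫ x, Ψ (‖g x + t • k x‖ ^ 2) ∂μ)
        (2 * ∫ x, ψ (‖g x‖ ^ 2) * inner ℝ (g x) (k x) ∂μ) 0 := by
  have hint : ∀ t : ℝ, Integrable (fun x => Ψ (‖g x + t • k x‖ ^ 2)) μ := fun t =>
    integrable_density hΨ hM hψ (hg.add (hk.const_smul t))
  have hflux : AEStronglyMeasurable (fun x => ψ (‖g x‖ ^ 2) * inner ℝ (g x) (k x)) μ :=
    ((continuous_comp_norm_sq hψc).comp_aestronglyMeasurable hg.1).mul (hg.1.inner hk.1)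
  have hbound : Integrable (fun x => 2 * (M * ((‖g x‖ + ‖k x‖) * ‖k x‖))) μ :=
    (((hg.norm.add hk.norm).integrable_mul hk.norm).const_mul M).const_mul 2
  have hf : Integrable (fun x => ψ (‖g x‖ ^ 2) * inner ℝ (g x) (k x)) μ :=
    ((hg.norm.integrable_mul hk.norm).const_mul M).mono' hflux <| Eventually.of_forall fun x => by
      simpa [mul_assoc] using abs_flux_le hψ (g x) (k x)
  refine ⟨hf, ?_⟩
  have key := hasDerivAt_integral_of_dominated_loc_of_deriv_le (μ := μ)
    (F := fun t x => Ψ (‖g x + t • k x‖ ^ 2))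
    (F' := fun t x => 2 * (ψ (‖g x + t • k x‖ ^ 2) * inner ℝ (g x + t • k x) (k x)))
    (x₀ := (0 : ℝ)) (s := Metric.ball 0 1)
    (bound := fun x => 2 * (M * ((‖g x‖ + ‖k x‖) * ‖k x‖)))
    (Metric.ball_mem_nhds _ one_pos) (Eventually.of_forall fun t => (hint t).1) (hint 0)
    (by simpa using hflux.const_mul 2) (Eventually.of_forall fun x t ht => by
      have ht1 : ‖t‖ ≤ 1 := (mem_ball_zero_iff.1 ht).le
      rw [norm_mul, Real.norm_ofNat, ← mul_assoc M]
      gcongr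
      refine (abs_flux_le hψ _ _).trans ?_
      gcongr
      refine (norm_add_le _ _).trans ?_
      rw [norm_smul]
      gcongr
      exact mul_le_of_le_one_left (norm_nonneg _) ht1) hbound
    (Eventually.of_forall fun x t _ => hasDerivAt_density hΨ (g x) (k x) t)
  simpa [integral_const_mul] using key.2

theorem abs_integral_flux_le (hψ : ∀ t, 0 ≤ t → |ψ (t ^ 2) * t| ≤ M * t) {g k : X → V}
    (hg : MemLp g 2 μ) (hk : MemLp k 2 μ) :
    |∫ x, ψ (‖g x‖ ^ 2) * inner ℝ (g x) (k x) ∂μ| ≤ M * ∫ x, ‖g x‖ * ‖k x‖ ∂μ := by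
  rw [← integral_const_mul]
  refine norm_integral_le_of_norm_le (f := fun x => ψ (‖g x‖ ^ 2) * inner ℝ (g x) (k x))
    ((hg.norm.integrable_mul hk.norm).const_mul M) (Eventually.of_forall fun x => ?_)
  simpa [mul_assoc] using abs_flux_le hψ (g x) (k x)

end Diffusion

/-! ### Transfer to `H¹₀(Ω)`. -/

section Sobolev

variable {d : ℕ} {Ω : Set (EuclideanSpace ℝ (Fin d))}

theorem fn_add_smul (v z : H10 Ω) (t : ℝ) :
    fn (v + t • z) =ᵐ[volume.restrict Ω] fun x => fn v x + t * fn z x := by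
  filter_upwards [Lp.coeFn_add (fn v) (t • fn z), Lp.coeFn_smul t (fn z)] with x h1 h2
  rw [Pi.add_apply, h2] at h1
  exact h1

theorem wgrad_add_smul (v z : H10 Ω) (t : ℝ) :
    wgrad (v + t • z) =ᵐ[volume.restrict Ω] fun x => wgrad v x + t • wgrad z x := by
  filter_upwards [Lp.coeFn_add (wgrad v) (t • wgrad z), Lp.coeFn_smul t (wgrad z)] with x h1 h2
  rw [Pi.add_apply, h2] at h1
  exact h1

theorem integral_norm_wgrad_mul_le (v z : H10 Ω) :
    ∫ x in Ω, ‖wgrad v x‖ * ‖wgrad z x‖ ≤ ‖wgrad v‖ * ‖wgrad z‖ := by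
  have h : ∀ v : H10 Ω, (∫ x in Ω, ‖wgrad v x‖ ^ (2 : ℝ)) ^ (1 / 2 : ℝ) = ‖wgrad v‖ := by
    intro v
    rw [Lp.norm_def, (Lp.memLp (wgrad v)).eLpNorm_eq_integral_rpow_norm (by simp) (by simp),
      ENNReal.toReal_ofReal (by positivity)]
    simp
  rw [← h, ← h]
  exact integral_mul_norm_le_Lp_mul_Lq Real.HolderConjugate.two_two
    (by simpa using Lp.memLp (wgrad v)) (by simpa using Lp.memLp (wgrad z))

theorem memLp_fn {r C : ℝ}
    (hC : ∀ v : H10 Ω,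
      eLpNorm (fn v) (ENNReal.ofReal (r + 1)) (volume.restrict Ω) ≤ ENNReal.ofReal (C * ‖wgrad v‖))
    (v : H10 Ω) : MemLp (fn v) (ENNReal.ofReal (r + 1)) (volume.restrict Ω) :=
  ⟨(Lp.memLp (fn v)).1, (hC v).trans_lt ENNReal.ofReal_lt_top⟩

theorem integral_abs_fn_rpow_le {r C : ℝ} (hr : 0 < r) (hC0 : 0 ≤ C)
    (hC : ∀ v : H10 Ω,
      eLpNorm (fn v) (ENNReal.ofReal (r + 1)) (volume.restrict Ω) ≤ ENNReal.ofReal (C * ‖wgrad v‖))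
    (v : H10 Ω) : ∫ x in Ω, |fn v x| ^ (r + 1) ≤ (C * ‖wgrad v‖) ^ (r + 1) := by
  have hr1 : 0 < r + 1 := by linarith
  have h := ENNReal.toReal_le_of_le_ofReal (by positivity) (hC v)
  rw [(memLp_fn hC v).eLpNorm_eq_integral_rpow_norm (by simpa using hr1) (by simp),
    ENNReal.toReal_ofReal hr1.le, ENNReal.toReal_ofReal (by positivity)] at h
  rw [Real.rpow_inv_le_iff_of_pos (by positivity) (by positivity) hr1] at h
  exact h

/-- The candidate for the derivative of the energy is linear in the direction. -/
theorem exists_linearMap_derivative (α : ℝ) {ψ : ℝ → ℝ} {f : EuclideanSpace ℝ (Fin d) → ℝ → ℝ}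
    (hd : ∀ v z : H10 Ω, Integrable
      (fun x => ψ (‖wgrad v x‖ ^ 2) * inner ℝ (wgrad v x) (wgrad z x)) (volume.restrict Ω))
    (hp : ∀ v z : H10 Ω, Integrable (fun x => f x (fn v x) * fn z x) (volume.restrict Ω)) :
    ∃ E' : H10 Ω → (H10 Ω →ₗ[ℝ] ℝ), ∀ v z, E' v z =
      α * (∫ x in Ω, ψ (‖wgrad v x‖ ^ 2) * inner ℝ (wgrad v x) (wgrad z x))
        - α * ∫ x in Ω, f x (fn v x) * fn z x :=
  ⟨fun v => IsLinearMap.mk' (fun z =>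
    α * (∫ x in Ω, ψ (‖wgrad v x‖ ^ 2) * inner ℝ (wgrad v x) (wgrad z x))
      - α * ∫ x in Ω, f x (fn v x) * fn z x) (by
    have hlin : ∀ (y z : H10 Ω) (t : ℝ),
        (∫ x in Ω, ψ (‖wgrad v x‖ ^ 2) * inner ℝ (wgrad v x) (wgrad (y + t • z) x)) =
          (∫ x in Ω, ψ (‖wgrad v x‖ ^ 2) * inner ℝ (wgrad v x) (wgrad y x)) +
            t * (∫ x in Ω, ψ (‖wgrad v x‖ ^ 2) * inner ℝ (wgrad v x) (wgrad z x)) ∧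
        (∫ x in Ω, f x (fn v x) * fn (y + t • z) x) =
          (∫ x in Ω, f x (fn v x) * fn y x) + t * ∫ x in Ω, f x (fn v x) * fn z x := by
      intro y z t
      constructor
      · rw [← integral_const_mul, ← integral_add (hd v y) ((hd v z).const_mul t)]
        refine integral_congr_ae ?_
        filter_upwards [wgrad_add_smul y z t] with x hx
        rw [hx, inner_add_right, real_inner_smul_right]
        ring
      · rw [← integral_const_mul, ← integral_add (hp v y) ((hp v z).const_mul t)]
        refine integral_congr_ae ?_
        filter_upwards [fn_add_smul y z t] with x hx
        rw [hx]
        ring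
    -- This reads `I(0) = I(0) + I(0)`, so both integrals vanish in the zero direction, as
    -- homogeneity requires.
    have h0 := hlin 0 0 1
    rw [one_smul, add_zero, one_mul, one_mul] at h0
    refine ⟨fun y z => ?_, fun t z => ?_⟩
    · have h := hlin y z 1
      rw [one_smul] at h
      rw [h.1, h.2]
      ring
    · have h := hlin 0 z t
      rw [zero_add] at h
      rw [h.1, h.2, smul_eq_mul]
      linear_combination -α * h0.1 + α * h0.2), fun _ _ => rfl⟩

/-- The lower equivalence constant `a` turns `N (w - v) ≤ ρ` into `‖∇v‖ ≤ ‖∇w‖ + ρ/a`, and `N z = 1`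
into `‖∇z‖ ≤ 1/a`. -/
theorem IsEquivalentNorm.propertyB {N : Seminorm ℝ (H10 Ω)} (hN : IsEquivalentNorm N)
    {E' : H10 Ω → (H10 Ω →ₗ[ℝ] ℝ)} (K : ℝ → ℝ → ℝ)
    (hK : ∀ (A B : ℝ) (v z : H10 Ω), ‖wgrad v‖ ≤ A → ‖wgrad z‖ ≤ B → |E' v z| ≤ K A B) :
    PropertyB N E' := by
  obtain ⟨a, b, ha, hb, hN⟩ := hN
  have hgrad : ∀ (v : H10 Ω) (s : ℝ), N v ≤ s → ‖wgrad v‖ ≤ s / a := fun v s hs => by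
    rw [le_div_iff₀ ha, mul_comm]
    exact (hN v).1.trans hs
  intro w ρ hρ
  refine ⟨max 0 (K (‖wgrad w‖ + ρ / a) (1 / a)), le_max_left _ _, fun v hv =>
    iSup₂_le fun z hz => ENNReal.ofReal_le_ofReal
      ((hK _ _ v z ?_ (hgrad z 1 hz.le)).trans (le_max_right _ _))⟩
  have h1 : wgrad v = wgrad w - wgrad (w - v) := (sub_sub_cancel (wgrad w) (wgrad v)).symm
  rw [h1]
  exact (norm_sub_le _ _).trans (by gcongr; exact hgrad _ _ hv)

/-- The representative of `v + t z` agrees with the pointwise line only off a null set depending on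
`t`, so the integrals are identified for each `t` before differentiating. The factor `2` cancels
against `α/2`. -/
theorem hasDerivAt_energy (α : ℝ) {Ψ : ℝ → ℝ} {F : EuclideanSpace ℝ (Fin d) → ℝ → ℝ}
    {v z : H10 Ω} {p q : ℝ}
    (hd : HasDerivAt (fun t : ℝ => ∫ x in Ω, Ψ (‖wgrad v x + t • wgrad z x‖ ^ 2)) (2 * p) 0)
    (hp : HasDerivAt (fun t : ℝ => ∫ x in Ω, F x (fn v x + t * fn z x)) q 0) :
    HasDerivAt (fun t : ℝ => energy α Ψ F (v + t • z)) (α * p - α * q) 0 := by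
  have hE : ∀ t : ℝ, energy α Ψ F (v + t • z) =
      α / 2 * (∫ x in Ω, Ψ (‖wgrad v x + t • wgrad z x‖ ^ 2)) -
        α * ∫ x in Ω, F x (fn v x + t * fn z x) := by
    intro t
    have h1 : (∫ x in Ω, Ψ (‖wgrad (v + t • z) x‖ ^ 2)) =
        ∫ x in Ω, Ψ (‖wgrad v x + t • wgrad z x‖ ^ 2) := by
      refine integral_congr_ae ?_
      filter_upwards [wgrad_add_smul v z t] with x hx
      rw [hx]
    have h2 : (∫ x in Ω, F x (fn (v + t • z) x)) = ∫ x in Ω, F x (fn v x + t * fn z x) := by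
      refine integral_congr_ae ?_
      filter_upwards [fn_add_smul v z t] with x hx
      rw [hx]
    rw [energy, h1, h2]
  simp only [hE]
  refine ((hd.const_mul (α / 2)).sub (hp.const_mul α)).congr_deriv ?_
  ring

end Sobolev

end DiffusionReaction

/-! ### The main theorem. -/

theorem mainTheorem7 {d : ℕ} (Ω : Set (EuclideanSpace ℝ (Fin d)))
    (hΩ : IsOpen Ω) (hΩb : Bornology.IsBounded Ω)
    (α : ℝ) (hα : 0 < α)
    -- `Ψ` is continuously differentiable on `[0, ∞)` with derivative `ψ`
    (Ψ ψ : ℝ → ℝ)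
    (hΨ : ∀ s, 0 ≤ s → HasDerivWithinAt Ψ (ψ s) (Set.Ici 0) s)
    (hψ : ContinuousOn ψ (Set.Ici 0))
    (m M : ℝ) (hm : 0 < m) (hmM : m ≤ M)
    (hmono : ∀ s t, 0 ≤ s → s ≤ t →
      m * (t - s) ≤ ψ (t ^ 2) * t - ψ (s ^ 2) * s ∧
        ψ (t ^ 2) * t - ψ (s ^ 2) * s ≤ M * (t - s))
    -- `F` is a potential of `f`
    (F f : EuclideanSpace ℝ (Fin d) → ℝ → ℝ)
    (hFmeas : ∀ z, AEStronglyMeasurable (fun x => F x z) (volume.restrict Ω))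
    (hFint : Integrable (fun x => F x 0) (volume.restrict Ω))
    (hFf : ∀ᵐ x ∂volume.restrict Ω, ∀ z, HasDerivAt (F x) (f x z) z)
    -- `r` is such that `H¹₀(Ω)` embeds continuously into `L^(r+1)(Ω)`
    (r : ℝ) (hr : 0 < r) (hembed : ContinuousSobolevEmbedding Ω (r + 1))
    (c₁ c₂ : ℝ) (hc₁ : 0 < c₁) (hc₂ : 0 < c₂)
    (hgrowth : ∀ᵐ x ∂volume.restrict Ω, ∀ t, |f x t| ≤ c₁ * |t| ^ r + c₂) :
    -- the energy is well defined
    (∀ v : H10 Ω,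
      Integrable (fun x => Ψ (‖wgrad v x‖ ^ 2)) (volume.restrict Ω) ∧
      Integrable (fun x => F x (fn v x)) (volume.restrict Ω)) ∧
    -- its Gateaux derivative `E'` exists, has the expected form, and satisfies (B)
    ∃ E' : H10 Ω → (H10 Ω →ₗ[ℝ] ℝ),
      (∀ v z : H10 Ω,
        Integrable (fun x => ψ (‖wgrad v x‖ ^ 2) * inner ℝ (wgrad v x) (wgrad z x))
          (volume.restrict Ω) ∧
        Integrable (fun x => f x (fn v x) * fn z x) (volume.restrict Ω) ∧
        E' v z = α * (∫ x in Ω, ψ (‖wgrad v x‖ ^ 2) * inner ℝ (wgrad v x) (wgrad z x))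
          - α * ∫ x in Ω, f x (fn v x) * fn z x) ∧
      ∀ N : Seminorm ℝ (H10 Ω), IsEquivalentNorm N →
        (∀ v, IsGateauxDeriv N
          (energy α Ψ F) v (E' v)) ∧
        PropertyB N E' := by
  obtain ⟨C, hC0, hC⟩ := hembed
  have : IsFiniteMeasure (volume.restrict Ω) := ⟨by simpa using hΩb.measure_lt_top⟩
  have hM : 0 ≤ M := hm.le.trans hmM
  have hflux : ∀ t, 0 ≤ t → |ψ (t ^ 2) * t| ≤ M * t := by
    intro t ht
    -- The lower bound fixes the sign of `ψ(t²)t`; the upper bound gives the size.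
    have h := hmono 0 t le_rfl ht
    simp only [mul_zero, sub_zero] at h
    rw [abs_of_nonneg ((mul_nonneg hm.le ht).trans h.1)]
    exact h.2
  have hL := memLp_fn hC
  have hG : ∀ v : H10 Ω, MemLp (wgrad v) 2 (volume.restrict Ω) := fun v => Lp.memLp _
  have hd := fun v z : H10 Ω => hasDerivAt_integral_density hΨ hψ hM hflux (hG v) (hG z)
  have hp := fun v z : H10 Ω => hasDerivAt_integral_potential hFmeas hFint hFf hr hc₁.le hc₂.le
    hgrowth (hL v) (hL z)
  refine ⟨fun v => ⟨integrable_density hΨ hM hflux (hG v),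
    integrable_potential hFmeas hFint hFf hr hc₁.le hc₂.le hgrowth (hL v)⟩, ?_⟩
  obtain ⟨E', hE'⟩ := exists_linearMap_derivative α (fun v z => (hd v z).1) fun v z => (hp v z).1
  refine ⟨E', fun v z => ⟨(hd v z).1, (hp v z).1, hE' v z⟩, ?_⟩
  have hbound : ∀ (A B : ℝ) (v z : H10 Ω), ‖wgrad v‖ ≤ A → ‖wgrad z‖ ≤ B →
      |E' v z| ≤ α * (M * (A * B)) + α * (c₁ * ((C * A) ^ (r + 1) + (C * B) ^ (r + 1)) +
        c₂ * ((volume.restrict Ω).real univ + (C * B) ^ (r + 1))) := by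
    intro A B v z hA hB
    have hA0 := (norm_nonneg _).trans hA
    have hB0 := (norm_nonneg _).trans hB
    have hv := integral_abs_fn_rpow_le hr hC0.le hC v
    have hz := integral_abs_fn_rpow_le hr hC0.le hC z
    have h1 : |∫ x in Ω, ψ (‖wgrad v x‖ ^ 2) * inner ℝ (wgrad v x) (wgrad z x)| ≤ M * (A * B) := by
      refine (abs_integral_flux_le hflux (hG v) (hG z)).trans ?_
      gcongr
      exact (integral_norm_wgrad_mul_le v z).trans (by gcongr)
    have h2 : |∫ x in Ω, f x (fn v x) * fn z x| ≤
        c₁ * ((C * A) ^ (r + 1) + (C * B) ^ (r + 1)) +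
          c₂ * ((volume.restrict Ω).real univ + (C * B) ^ (r + 1)) := by
      refine (abs_integral_reaction_le hr hc₁.le hc₂.le hgrowth (hL v) (hL z)).trans ?_
      gcongr
      · exact hv.trans (by gcongr)
      · exact hz.trans (by gcongr)
      · exact hz.trans (by gcongr)
    rw [hE']
    refine (abs_sub _ _).trans ?_
    rw [abs_mul, abs_mul, abs_of_pos hα]
    gcongr
  intro N hN
  have hB : PropertyB N E' := hN.propertyB (fun A B => α * (M * (A * B)) +
    α * (c₁ * ((C * A) ^ (r + 1) + (C * B) ^ (r + 1)) +
      c₂ * ((volume.restrict Ω).real univ + (C * B) ^ (r + 1)))) hbound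
  refine ⟨fun v => ⟨?_, fun z => ?_⟩, hB⟩
  -- Boundedness of `E'(v)` is (B) with `w = v`; the radius is arbitrary.
  · obtain ⟨R, -, hR⟩ := hB v 1 one_pos
    exact (hR v (by simp)).trans_lt ENNReal.ofReal_lt_top
  · have h := (hasDerivAt_energy α (hd v z).2 (hp v z).2).tendsto_slope_zero
    simpa only [hE', zero_add, zero_smul, add_zero, div_eq_inv_mul, smul_eq_mul] using h
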